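/- Let $\mathbb{F}_q$ be a finite field with $q \ge 4$ elements, and let $d, s$ be integers with $3 \le d$ and $2d+2 \le s$. Let $X = (\mathbb{F}_q^*)^s$ and let $I_X \subset \mathbb{F}_q[t_1,\dots,t_s]$ be the ideal of polynomials vanishing at all points of $X$; let $\varphi : \mathbb{F}_q[t_1,\dots,t_s]/I_X \to \mathbb{F}_q^{X}$, $f + I_X \mapsto (f(P))_{P\in X}$, be the evaluation map. Let $R(d) \subset \mathbb{R}^s$ be the hypersimplex, i.e. the convex hull of the points $e_{i_1}+\cdots+e_{i_d}$ with $1 \le i_1 < \cdots < i_d \le s$, where $e_1,\dots,e_s$ is the canonical basis of $\mathbb{R}^s$. Let $\mathcal{L}(d)$ be the $\mathbb{F}_q$-linear span of the classes $t_1^{\alpha_1}\cdots t_s^{\alpha_s} + I_X$ with $(\alpha_1,\dots,\alpha_s) \in R(d)\cap\mathbb{Z}^s$, and let $\mathcal{C}(d) = \varphi(\mathcal{L}(d))$ be the associated toric code. Then the next-to-minimal weight of $\mathcal{C}(d)$, that is, the second smallest value taken by the Hamming weight on the nonzero codewords of $\mathcal{C}(d)$, is $$(q-2)^d(q-1)^{s-d}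 + (q-2)^d(q-1)^{s-d-2}.$$ Moreover, the polynomial $$f = \left(\prod_{i=1}^{d-1}(t_i - t_{d-1+i})\right)(t_{2d-1} - t_{2d} + t_{2d+1} - t_{2d+2})$$ satisfies $f + I_X \in \mathcal{L}(d)$, and the codeword $\varphi(f+I_X)$ has this weight. -/

import Mathlib

open MvPolynomial

noncomputable section

/-- The affine torus `X = (F^*)^s`, as a subset of `F^s`. -/
def torus (F : Type*) [Field F] (s : ℕ) : Set (Fin s → F) := {P | ∀ i, P i ≠ 0}

instance torus.decidablePred (F : Type*) [Field F] [DecidableEq F] (s : ℕ) :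
    DecidablePred (· ∈ torus F s) :=
  fun P => inferInstanceAs (Decidable (∀ i, P i ≠ 0))

/-- For `X ⊆ F^s` with vanishing ideal `I_X`, the evaluation map
`F[t_1, …, t_s] / I_X → F^X`, `f + I_X ↦ (f(P))_{P ∈ X}`. -/
def evalMap {F : Type*} [Field F] {s : ℕ} (X : Set (Fin s → F)) :
    (MvPolynomial (Fin s) F ⧸ vanishingIdeal F X) →ₗ[F] (X → F) :=
  (Ideal.Quotient.liftₐ (vanishingIdeal F X)
    (AlgHom.pi fun P : X => (aeval (P : Fin s → F) : MvPolynomial (Fin s) F →ₐ[F] F))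
    (fun f hf => funext fun P => hf P P.2)).toLinearMap

/-- For `R ⊆ ℝ^s` (in the theory, a lattice polytope contained in `[0, q-2]^s`), the span
of the classes modulo the vanishing ideal of the torus of the monomials
`t_1^{α_1} ⋯ t_s^{α_s}` whose exponent vector lies in `R`. -/
def toricSpace (F : Type*) [Field F] {s : ℕ} (R : Set (Fin s → ℝ)) :
    Submodule F (MvPolynomial (Fin s) F ⧸ vanishingIdeal F (torus F s)) :=
  Submodule.span F
    {m | ∃ α : Fin s →₀ ℕ, (fun i => (α i : ℝ)) ∈ R ∧
      m = Ideal.Quotient.mk (vanishingIdeal F (torus F s)) (monomial α 1)}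

/-- The toric code of `R`: the image of `toricSpace F R` under evaluation at the points of
the torus. -/
def toricCode (F : Type*) [Field F] {s : ℕ} (R : Set (Fin s → ℝ)) :
    Submodule F (torus F s → F) :=
  (toricSpace F R).map (evalMap (torus F s))

/-- The hypersimplex `R(d) ⊆ ℝ^s`: the convex hull of the points `e_{i_1} + ⋯ + e_{i_d}` with
`i_1 < ⋯ < i_d`. -/
def hypersimplex (s d : ℕ) : Set (Fin s → ℝ) :=
  convexHull ℝ {x | ∃ A : Finset (Fin s), A.card = d ∧ x = ∑ i ∈ A, Pi.single i (1 : ℝ)}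

/-- The set of Hamming weights of the nonzero codewords of a linear code. -/
def nonzeroWeights {F ι : Type*} [Field F] [DecidableEq F] [Fintype ι]
    (C : Submodule F (ι → F)) : Set ℕ :=
  {w | ∃ c ∈ C, c ≠ 0 ∧ hammingNorm c = w}

/-- `w` is the next-to-minimal weight of `C`: the least weight of a codeword that is strictly
larger than the minimum distance `δ` of `C`. -/
def IsNextToMinimalWeight {F ι : Type*} [Field F] [DecidableEq F] [Fintype ι]
    (C : Submodule F (ι → F)) (w : ℕ) : Prop :=
  ∃ δ, IsLeast (nonzeroWeights C) δ ∧ IsLeast {v ∈ nonzeroWeights C | δ < v} w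

/-- The polynomial
`∏_{i=1}^{d-1} (t_i - t_{d-1+i}) * (t_{2d-1} - t_{2d} + t_{2d+1} - t_{2d+2})`;
the variable `t_k` is `X ⟨k - 1, _⟩`. -/
def nextToMinimalPoly (F : Type*) [Field F] (s d : ℕ) (h : 2 * d + 2 ≤ s) :
    MvPolynomial (Fin s) F :=
  (∏ i : Fin (d - 1), (X ⟨i, by omega⟩ - X ⟨d - 1 + i, by omega⟩)) *
    (X ⟨2 * d - 2, by omega⟩ - X ⟨2 * d - 1, by omega⟩ + X ⟨2 * d, by omega⟩
      - X ⟨2 * d + 1, by omega⟩)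

end

/-! Let `Q = q - 1 ≥ 3`, and let `n` be the number of variables. On the torus a codeword is a
squarefree form of degree `d`, and a nonzero one can be written `f = x_i g + h` with `g ≠ 0` and
neither `g` nor `h` involving `x_i`. Along a line parallel to the `i`-th axis, `f` has at least `Q -
1` nonzeros if `g ≠ 0` there, and `Q` if `g = 0 ≠ h`. Writing `|·|` for the Hamming weight, this
gives `Q|f| ≥ (Q-1)|g| + Q·#{g = 0, h ≠ 0}` (`le_hammingNorm_coordFun_mul_add`). Induction on `d`
yields the minimum `((Q-1)/Q)^d Q^n`, attained by products of `d` binomials `x_i - c x_j` in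
disjoint pairs of variables.

The gap is `isBinomialProduct_or_le_hammingNorm`: any other nonzero form has at least `1 + 1/Q²`
times this weight. If `g` is not a binomial product, the factor is inherited from `g`. If it is,
each binomial of `g` either divides `h`, and is split off from `f`, or `h` has many nonzeros on its
zero set (`binomial_dvd_or_le_card`). These lie among the zeros of `g`, so they enter the second
term of the fibre inequality and supply the excess `1/Q²`. When all binomials have been split off, a
linear form remains, treated by `linear_dichotomy`.

The excess is attained by `d - 1` binomials times a signed sum of four further variables.

All weights are counted on the full torus, unused variables included, and denominators are cleared
by powers of `Q`. -/

noncomputable section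

/-! ### Squarefree forms as functions on the torus. -/

section SquarefreeForms

variable {F ι : Type*} [Field F]

/-- The `i`-th coordinate function on the torus. -/
def coordFun (F : Type*) [Field F] {ι : Type*} (i : ι) : (ι → Fˣ) → F := fun P => (P i : F)

/-- The functions on the torus given by forms of degree `d` which are linear combinations of
squarefree monomials in the variables indexed by `V`. -/
def sqfreeForms (F : Type*) [Field F] {ι : Type*} (V : Finset ι) (d : ℕ) :
    Submodule F ((ι → Fˣ) → F) :=
  Submodule.span F {m | ∃ A ⊆ V, A.card = d ∧ m = ∏ i ∈ A, coordFun F i}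

theorem sqfreeForms_mono {V W : Finset ι} (h : V ⊆ W) (d : ℕ) :
    sqfreeForms F V d ≤ sqfreeForms F W d := by
  apply Submodule.span_mono
  rintro m ⟨A, hA, hc, rfl⟩
  exact ⟨A, hA.trans h, hc, rfl⟩

theorem exists_smul_one_of_mem_sqfreeForms_zero {V : Finset ι} {f : (ι → Fˣ) → F}
    (hf : f ∈ sqfreeForms F V 0) : ∃ c : F, f = c • (1 : (ι → Fˣ) → F) := by
  have : sqfreeForms F V 0 ≤ Submodule.span F {(1 : (ι → Fˣ) → F)} := by
    apply Submodule.span_mono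
    rintro m ⟨A, -, hc, rfl⟩
    simp [Finset.card_eq_zero.mp hc]
  obtain ⟨c, hc⟩ := Submodule.mem_span_singleton.mp (this hf)
  exact ⟨c, hc.symm⟩

theorem one_mem_sqfreeForms (V : Finset ι) : (1 : (ι → Fˣ) → F) ∈ sqfreeForms F V 0 :=
  Submodule.subset_span ⟨∅, by simp, rfl, by simp⟩

theorem coordFun_mem_sqfreeForms {V : Finset ι} {i : ι} (h : i ∈ V) :
    coordFun F i ∈ sqfreeForms F V 1 :=
  Submodule.subset_span ⟨{i}, by simpa using h, by simp, by simp⟩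

variable [DecidableEq ι]

theorem coordFun_mul_mem_sqfreeForms {V : Finset ι} {i : ι} (hi : i ∉ V) {d : ℕ}
    {f : (ι → Fˣ) → F} (hf : f ∈ sqfreeForms F V d) :
    coordFun F i * f ∈ sqfreeForms F (insert i V) (d + 1) := by
  induction hf using Submodule.span_induction with
  | mem x hx =>
    obtain ⟨A, hA, hc, rfl⟩ := hx
    have hiA : i ∉ A := fun h => hi (hA h)
    refine Submodule.subset_span ⟨insert i A, Finset.insert_subset_insert i hA, ?_, ?_⟩
    · rw [Finset.card_insert_of_notMem hiA, hc]
    · rw [Finset.prod_insert hiA]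
  | zero => simp
  | add x y _ _ hx hy => rw [mul_add]; exact add_mem hx hy
  | smul a x _ hx => rw [mul_smul_comm]; exact Submodule.smul_mem _ a hx

/-- Separating the terms that contain the variable `i`. -/
theorem exists_eq_coordFun_mul_add {V : Finset ι} {i : ι} {d : ℕ}
    {f : (ι → Fˣ) → F} (hf : f ∈ sqfreeForms F V (d + 1)) :
    ∃ g ∈ sqfreeForms F (V.erase i) d, ∃ h ∈ sqfreeForms F (V.erase i) (d + 1),
      f = coordFun F i * g + h := by
  induction hf using Submodule.span_induction with
  | mem x hx =>
    obtain ⟨A, hA, hc, rfl⟩ := hx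
    by_cases hi : i ∈ A
    · refine ⟨∏ j ∈ A.erase i, coordFun F j, Submodule.subset_span
        ⟨A.erase i, Finset.erase_subset_erase i hA, ?_, rfl⟩, 0, zero_mem _, ?_⟩
      · rw [Finset.card_erase_of_mem hi, hc]; rfl
      · rw [Finset.mul_prod_erase A _ hi, add_zero]
    · exact ⟨0, zero_mem _, _, Submodule.subset_span
        ⟨A, Finset.subset_erase.mpr ⟨hA, hi⟩, hc, rfl⟩, by simp⟩
  | zero => exact ⟨0, zero_mem _, 0, zero_mem _, by simp⟩
  | add x y _ _ hx hy =>
    obtain ⟨g, hg, h, hh, rfl⟩ := hx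
    obtain ⟨g', hg', h', hh', rfl⟩ := hy
    exact ⟨g + g', add_mem hg hg', h + h', add_mem hh hh', by ring⟩
  | smul a x _ hx =>
    obtain ⟨g, hg, h, hh, rfl⟩ := hx
    exact ⟨a • g, Submodule.smul_mem _ a hg, a • h, Submodule.smul_mem _ a hh, by
      rw [smul_add, mul_smul_comm]⟩

/-- Variables with zero coefficient are discarded from `V` one at a time. This must stop, because no
nonzero form of positive degree exists in no variables. -/
theorem exists_ne_zero_eq_coordFun_mul_add {V : Finset ι} {d : ℕ} {f : (ι → Fˣ) → F}
    (hf : f ∈ sqfreeForms F V (d + 1)) (h0 : f ≠ 0) :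
    ∃ i ∈ V, ∃ g ∈ sqfreeForms F (V.erase i) d, g ≠ 0 ∧
      ∃ h ∈ sqfreeForms F (V.erase i) (d + 1), f = coordFun F i * g + h := by
  induction V using Finset.induction_on with
  | empty =>
    refine absurd ?_ h0
    have : sqfreeForms F (∅ : Finset ι) (d + 1) ≤ ⊥ := by
      refine Submodule.span_le.mpr ?_
      rintro m ⟨A, hA, hc, rfl⟩
      simp [Finset.subset_empty.mp hA] at hc
    simpa using this hf
  | insert i V hi ih =>
    obtain ⟨g, hg, h, hh, hfe⟩ := exists_eq_coordFun_mul_add (i := i) hf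
    by_cases hg0 : g = 0
    · rw [Finset.erase_insert hi] at hh
      have hfh : f = h := by simp [hfe, hg0]
      obtain ⟨j, hj, g', hg', hg0', h', hh', e⟩ := ih (hfh ▸ hh)
      have hsub : V.erase j ⊆ (insert i V).erase j :=
        Finset.erase_subset_erase j (Finset.subset_insert i V)
      exact ⟨j, Finset.mem_insert_of_mem hj, g', sqfreeForms_mono hsub _ hg', hg0', h',
        sqfreeForms_mono hsub _ hh', e⟩
    · exact ⟨i, Finset.mem_insert_self i V, g, hg, hg0, h, hh, hfe⟩

/-- `f` does not depend on the `i`-th coordinate. -/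
def IndepOfCoord (i : ι) (f : (ι → Fˣ) → F) : Prop :=
  ∀ P a, f (Function.update P i a) = f P

theorem indepOfCoord_coordFun {i j : ι} (h : i ≠ j) : IndepOfCoord i (coordFun F j) := by
  intro P a
  simp [coordFun, Function.update_of_ne h.symm]

theorem coordFun_update (i : ι) (P : ι → Fˣ) (a : Fˣ) :
    coordFun F i (Function.update P i a) = a := by
  simp [coordFun]

theorem IndepOfCoord.add {i : ι} {f g : (ι → Fˣ) → F} (hf : IndepOfCoord i f)
    (hg : IndepOfCoord i g) : IndepOfCoord i (f + g) := by
  intro P a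
  simp [hf P a, hg P a]

theorem IndepOfCoord.sub {i : ι} {f g : (ι → Fˣ) → F} (hf : IndepOfCoord i f)
    (hg : IndepOfCoord i g) : IndepOfCoord i (f - g) := by
  intro P a
  simp [hf P a, hg P a]

theorem IndepOfCoord.mul {i : ι} {f g : (ι → Fˣ) → F} (hf : IndepOfCoord i f)
    (hg : IndepOfCoord i g) : IndepOfCoord i (f * g) := by
  intro P a
  simp [hf P a, hg P a]

theorem IndepOfCoord.smul {i : ι} {f : (ι → Fˣ) → F} (c : F) (hf : IndepOfCoord i f) :
    IndepOfCoord i (c • f) := by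
  intro P a
  simp [hf P a]

theorem indepOfCoord_of_mem_sqfreeForms {V : Finset ι} {i : ι} (hi : i ∉ V) {d : ℕ}
    {f : (ι → Fˣ) → F} (hf : f ∈ sqfreeForms F V d) : IndepOfCoord i f := by
  induction hf using Submodule.span_induction with
  | mem x hx =>
    obtain ⟨A, hA, hc, rfl⟩ := hx
    intro P a
    simp only [Finset.prod_apply]
    refine Finset.prod_congr rfl fun j hj => ?_
    exact indepOfCoord_coordFun (fun h : i = j => hi (hA (h ▸ hj))) P a
  | zero => intro P a; rfl
  | add x y _ _ hx hy => exact hx.add hy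
  | smul a x _ hx => exact hx.smul a

end SquarefreeForms

/-! ### Counting nonzeros along lines parallel to an axis. -/

section FibreCounting

variable {F ι : Type*} [Field F] [Fintype F] [DecidableEq F] [Fintype ι] [DecidableEq ι]

/-- Exchanging `P i` with `a` is an involution on the pairs `(P, a)`. -/
theorem sum_sum_update {A M : Type*} [Fintype A] [AddCommMonoid M] (i : ι)
    (φ : (ι → A) → M) :
    ∑ P, ∑ a, φ (Function.update P i a) = Fintype.card A • ∑ P, φ P := by
  have hinv : Function.Involutive
      (fun x : (ι → A) × A => (Function.update x.1 i x.2, x.1 i)) := by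
    rintro ⟨P, a⟩
    simp
  rw [← Fintype.sum_prod_type' (f := fun P a => φ (Function.update P i a))]
  refine (Equiv.sum_comp hinv.toPerm (fun x : (ι → A) × A => φ x.1)).trans ?_
  rw [Fintype.sum_prod_type]
  simp [Finset.smul_sum]

omit [Fintype F] in
theorem hammingNorm_eq_sum {α : Type*} [Fintype α] (f : α → F) :
    (hammingNorm f : ℚ) = ∑ P, if f P ≠ 0 then 1 else 0 := by
  rw [hammingNorm, Finset.card_filter]
  push_cast
  rfl

/-- Counting the nonzeros of `f` along the lines parallel to the `i`-th axis. -/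
theorem card_units_mul_hammingNorm (i : ι) (f : (ι → Fˣ) → F) :
    (Fintype.card Fˣ : ℚ) * hammingNorm f =
      ∑ P, (hammingNorm fun a : Fˣ => f (Function.update P i a) : ℚ) := by
  simp_rw [hammingNorm_eq_sum]
  rw [sum_sum_update i (fun P => if f P ≠ 0 then (1 : ℚ) else 0), nsmul_eq_mul]

omit [Fintype F] in
theorem hammingNorm_add_card_zeros {α : Type*} [Fintype α] (f : α → F) :
    hammingNorm f + (Finset.univ.filter fun a => f a = 0).card = Fintype.card α := by
  have := Finset.card_filter_add_card_filter_not (s := (Finset.univ : Finset α))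
    (fun a => f a = 0)
  rw [Finset.card_univ] at this
  rw [hammingNorm]
  simp only [ne_eq]
  omega

theorem hammingNorm_linear_of_ne_zero {g h : F} (hg : g ≠ 0) (hh : h ≠ 0) :
    (hammingNorm fun a : Fˣ => (a : F) * g + h : ℚ) = Fintype.card Fˣ - 1 := by
  have h1 := hammingNorm_add_card_zeros (fun a : Fˣ => (a : F) * g + h)
  have h2 : (Finset.univ.filter fun a : Fˣ => (a : F) * g + h = 0) =
      {Units.mk0 (-h / g) (by simp [hg, hh])} := by
    ext a
    simp only [Finset.mem_filter, Finset.mem_univ, true_and, Finset.mem_singleton, Units.ext_iff,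
      Units.val_mk0, eq_div_iff hg]
    exact eq_neg_iff_add_eq_zero.symm
  rw [h2, Finset.card_singleton] at h1
  rw [← h1]
  push_cast
  ring

omit [Fintype F] in
theorem hammingNorm_of_forall_ne_zero {α : Type*} [Fintype α] {f : α → F} (h : ∀ a, f a ≠ 0) :
    hammingNorm f = Fintype.card α := by
  simp [hammingNorm, h]

theorem hammingNorm_linear_ge (g h : F) :
    ((Fintype.card Fˣ : ℚ) - 1) * (if g ≠ 0 then 1 else 0) +
      Fintype.card Fˣ * (if g = 0 ∧ h ≠ 0 then 1 else 0) ≤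
      (hammingNorm fun a : Fˣ => (a : F) * g + h : ℚ) := by
  by_cases hg : g = 0
  · by_cases hh : h = 0
    · simp [hg, hh]
    · rw [hammingNorm_of_forall_ne_zero (by simpa [hg] using hh)]
      simp [hg, hh]
  · by_cases hh : h = 0
    · rw [hammingNorm_of_forall_ne_zero (by simpa [hh] using hg)]
      simp [hg]
    · rw [hammingNorm_linear_of_ne_zero hg hh]
      simp [hg]

theorem hammingNorm_quadratic_ge {f : F} (hf : f ≠ 0) (g h : F) :
    ((Fintype.card Fˣ : ℚ) - 2) ≤
      (hammingNorm fun a : Fˣ => (a : F) ^ 2 * f + (a : F) * g + h : ℚ) := by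
  classical
  have h1 := hammingNorm_add_card_zeros (fun a : Fˣ => (a : F) ^ 2 * f + (a : F) * g + h)
  set p : Polynomial F := Polynomial.C f * Polynomial.X ^ 2 + Polynomial.C g * Polynomial.X +
    Polynomial.C h with hp
  have hdeg : p.natDegree = 2 := Polynomial.natDegree_quadratic hf
  have hp0 : p ≠ 0 := by
    intro h0
    rw [h0] at hdeg
    simp at hdeg
  have h2 : (Finset.univ.filter fun a : Fˣ => (a : F) ^ 2 * f + (a : F) * g + h = 0).card ≤ 2 := by
    rw [← Finset.card_map ⟨Units.val, Units.val_injective⟩]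
    refine le_trans ?_ (hdeg ▸ p.card_roots')
    refine le_trans (Finset.card_le_card ?_) p.roots.toFinset_card_le
    intro x hx
    obtain ⟨a, ha, rfl⟩ := Finset.mem_map.mp hx
    rw [Multiset.mem_toFinset, Polynomial.mem_roots hp0]
    have ha := (Finset.mem_filter.mp ha).2
    simp only [Function.Embedding.coeFn_mk, Polynomial.IsRoot, hp, Polynomial.eval_add,
      Polynomial.eval_mul, Polynomial.eval_C, Polynomial.eval_pow, Polynomial.eval_X]
    linear_combination ha
  rw [← h1]
  have : ((Finset.univ.filter fun a : Fˣ => (a : F) ^ 2 * f + (a : F) * g + h = 0).card : ℚ) ≤ 2 := by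
    exact_mod_cast h2
  push_cast
  linarith

/-- The number of nonzeros of `x_i g + h` in terms of those of `g` and `h`. -/
theorem le_hammingNorm_coordFun_mul_add {i : ι} {g h : (ι → Fˣ) → F} (hg : IndepOfCoord i g)
    (hh : IndepOfCoord i h) :
    ((Fintype.card Fˣ : ℚ) - 1) * hammingNorm g +
      Fintype.card Fˣ * (Finset.univ.filter fun P => g P = 0 ∧ h P ≠ 0).card ≤
      Fintype.card Fˣ * hammingNorm (coordFun F i * g + h) := by
  rw [card_units_mul_hammingNorm i (coordFun F i * g + h), hammingNorm_eq_sum g,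
    Finset.card_filter, Nat.cast_sum, Finset.mul_sum, Finset.mul_sum, ← Finset.sum_add_distrib]
  refine Finset.sum_le_sum fun P _ => ?_
  have := hammingNorm_linear_ge (g P) (h P)
  simpa [hg P, hh P, coordFun_update] using this

theorem le_hammingNorm_coordFun_mul_add' {i : ι} {g h : (ι → Fˣ) → F} (hg : IndepOfCoord i g)
    (hh : IndepOfCoord i h) :
    ((Fintype.card Fˣ : ℚ) - 1) * hammingNorm g ≤
      Fintype.card Fˣ * hammingNorm (coordFun F i * g + h) :=
  le_trans (le_add_of_nonneg_right (by positivity)) (le_hammingNorm_coordFun_mul_add hg hh)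

theorem le_hammingNorm_quadratic {i : ι} {f g h : (ι → Fˣ) → F} (hf : IndepOfCoord i f)
    (hg : IndepOfCoord i g) (hh : IndepOfCoord i h) :
    ((Fintype.card Fˣ : ℚ) - 2) * hammingNorm f ≤
      Fintype.card Fˣ * hammingNorm (coordFun F i ^ 2 * f + coordFun F i * g + h) := by
  rw [card_units_mul_hammingNorm i, hammingNorm_eq_sum f, Finset.mul_sum]
  refine Finset.sum_le_sum fun P _ => ?_
  by_cases h0 : f P = 0
  · simp [h0]
  · have := hammingNorm_quadratic_ge h0 (g P) (h P)
    simpa [hf P, hg P, hh P, coordFun_update, h0] using this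

/-- A linear form `x_i a + h` with `a ≠ 0` has one zero on each line along which `h ≠ 0`. -/
theorem hammingNorm_coordFun_mul_add {i : ι} {g h : (ι → Fˣ) → F} (hg0 : ∀ P, g P ≠ 0)
    (hg : IndepOfCoord i g) (hh : IndepOfCoord i h) :
    (Fintype.card Fˣ : ℚ) * hammingNorm (coordFun F i * g + h) =
      Fintype.card Fˣ ^ (Fintype.card ι + 1) - hammingNorm h := by
  have hc : ((Fintype.card Fˣ : ℚ)) ^ (Fintype.card ι + 1) =
      ∑ _P : ι → Fˣ, (Fintype.card Fˣ : ℚ) := by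
    simp [pow_succ]
  rw [card_units_mul_hammingNorm i, hammingNorm_eq_sum h, hc, ← Finset.sum_sub_distrib]
  refine Finset.sum_congr rfl fun P _ => ?_
  simp only [Pi.add_apply, Pi.mul_apply, coordFun_update, hg P, hh P]
  by_cases h0 : h P = 0
  · rw [hammingNorm_of_forall_ne_zero (by simpa [h0] using hg0 P)]
    simp [h0]
  · rw [hammingNorm_linear_of_ne_zero (hg0 P) h0]
    simp [h0]

/-- A binomial factor `x_i - u`, with `u` nowhere zero, scales the weight by
`(|Fˣ| - 1) / |Fˣ|`. -/
theorem hammingNorm_coordFun_sub_mul {i : ι} {u g : (ι → Fˣ) → F} (hu0 : ∀ P, u P ≠ 0)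
    (hu : IndepOfCoord i u) (hg : IndepOfCoord i g) :
    (Fintype.card Fˣ : ℚ) * hammingNorm ((coordFun F i - u) * g) =
      (Fintype.card Fˣ - 1) * hammingNorm g := by
  rw [card_units_mul_hammingNorm i, hammingNorm_eq_sum g, Finset.mul_sum]
  refine Finset.sum_congr rfl fun P _ => ?_
  simp only [Pi.sub_apply, Pi.mul_apply, coordFun_update, hg P, hu P]
  by_cases h0 : g P = 0
  · simp [h0, hammingNorm]
  · have := hammingNorm_linear_of_ne_zero h0
      (mul_ne_zero (neg_ne_zero.mpr (hu0 P)) h0)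
    simp only [sub_mul]
    simpa [h0, sub_eq_add_neg] using this

/-- The nonzeros of `h` on the graph `x_i = u`. -/
theorem card_graph_mul {i : ι} {u h₁ h : (ι → Fˣ) → F} (hu0 : ∀ P, u P ≠ 0)
    (hu : IndepOfCoord i u) (hh₁ : IndepOfCoord i h₁)
    (he : ∀ P, coordFun F i P = u P → h P = h₁ P) :
    (hammingNorm h₁ : ℚ) ≤ Fintype.card Fˣ *
      (Finset.univ.filter fun P => coordFun F i P - u P = 0 ∧ h P ≠ 0).card := by
  rw [Finset.card_filter, Nat.cast_sum]
  have := sum_sum_update (A := Fˣ) i (fun P =>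
    (((if coordFun F i P - u P = 0 ∧ h P ≠ 0 then 1 else 0 : ℕ)) : ℚ))
  rw [nsmul_eq_mul] at this
  rw [← this, hammingNorm_eq_sum]
  refine Finset.sum_le_sum fun P _ => ?_
  by_cases h0 : h₁ P = 0
  · simp only [h0, ne_eq, not_true_eq_false, if_false]
    positivity
  -- Each line meets the graph at the value `u P` of the `i`-th coordinate; that single term
  -- suffices.
  · refine le_trans ?_ (Finset.single_le_sum (fun a _ => by positivity)
      (Finset.mem_univ (Units.mk0 (u P) (hu0 P))))
    have h1 : coordFun F i (Function.update P i (Units.mk0 (u P) (hu0 P))) =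
        u (Function.update P i (Units.mk0 (u P) (hu0 P))) := by
      rw [coordFun_update, hu P]; rfl
    rw [he _ h1, h1, hh₁ P]
    simp [h0]

end FibreCounting

/-! ### Minimal weight, binomial products and the weight gap. -/

section Weights

variable {F ι : Type*} [Field F] [Fintype F] [DecidableEq F] [Fintype ι] [DecidableEq ι]

theorem one_le_card_units : (1 : ℚ) ≤ Fintype.card Fˣ := by
  exact_mod_cast Fintype.card_pos

theorem hammingNorm_of_mem_sqfreeForms_zero {V : Finset ι} {f : (ι → Fˣ) → F}
    (hf : f ∈ sqfreeForms F V 0) (h0 : f ≠ 0) :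
    (hammingNorm f : ℚ) = Fintype.card Fˣ ^ Fintype.card ι := by
  obtain ⟨c, rfl⟩ := exists_smul_one_of_mem_sqfreeForms_zero hf
  have hc : c ≠ 0 := by
    rintro rfl
    simp at h0
  rw [hammingNorm_of_forall_ne_zero (by simpa using hc)]
  simp

/-- The lower bound for the weight of a squarefree form of degree `d`. -/
theorem min_le_hammingNorm {V : Finset ι} {d : ℕ} {f : (ι → Fˣ) → F}
    (hf : f ∈ sqfreeForms F V d) (h0 : f ≠ 0) :
    ((Fintype.card Fˣ : ℚ) - 1) ^ d * Fintype.card Fˣ ^ Fintype.card ι ≤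
      Fintype.card Fˣ ^ d * hammingNorm f := by
  have hQ : (1 : ℚ) ≤ Fintype.card Fˣ := one_le_card_units
  induction d generalizing V f with
  | zero => simp [hammingNorm_of_mem_sqfreeForms_zero hf h0]
  | succ d ih =>
    obtain ⟨i, hi, g, hg, hg0, h, hh, rfl⟩ := exists_ne_zero_eq_coordFun_mul_add hf h0
    have h1 := ih hg hg0
    have h2 := le_hammingNorm_coordFun_mul_add'
      (indepOfCoord_of_mem_sqfreeForms (Finset.notMem_erase i V) hg)
      (indepOfCoord_of_mem_sqfreeForms (Finset.notMem_erase i V) hh)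
    have h3 := mul_le_mul_of_nonneg_left h1 (sub_nonneg.mpr hQ)
    have h4 := mul_le_mul_of_nonneg_left h2 (by positivity : (0 : ℚ) ≤ Fintype.card Fˣ ^ d)
    rw [pow_succ, pow_succ]
    linarith

/-- Products of a nonzero constant and `d` binomials `x_i - c x_j` in pairwise disjoint pairs of
variables from `V`. -/
inductive IsBinomialProduct : Finset ι → ℕ → ((ι → Fˣ) → F) → Prop
  | const (V : Finset ι) (c : F) (hc : c ≠ 0) :
      IsBinomialProduct V 0 (c • (1 : (ι → Fˣ) → F))
  | mul {V : Finset ι} {d : ℕ} {g : (ι → Fˣ) → F} (i j : ι) (c : F) (hi : i ∈ V) (hj : j ∈ V)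
      (hij : i ≠ j) (hc : c ≠ 0) (hg : IsBinomialProduct ((V.erase i).erase j) d g) :
      IsBinomialProduct V (d + 1) ((coordFun F i - c • coordFun F j) * g)

omit [Fintype F] [DecidableEq F] [Fintype ι] in
theorem sub_mul_mem_sqfreeForms {V : Finset ι} {d : ℕ} {g : (ι → Fˣ) → F} {i j : ι} (c : F)
    (hi : i ∈ V) (hj : j ∈ V) (hij : i ≠ j)
    (hg : g ∈ sqfreeForms F ((V.erase i).erase j) d) :
    (coordFun F i - c • coordFun F j) * g ∈ sqfreeForms F V (d + 1) := by
  have hj' : j ∈ V.erase i := Finset.mem_erase.mpr ⟨hij.symm, hj⟩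
  rw [sub_mul, smul_mul_assoc]
  refine sub_mem ?_ (Submodule.smul_mem _ _ ?_)
  · have := coordFun_mul_mem_sqfreeForms (Finset.notMem_erase i V)
      (sqfreeForms_mono (Finset.erase_subset j _) d hg)
    rwa [Finset.insert_erase hi] at this
  · have := coordFun_mul_mem_sqfreeForms (Finset.notMem_erase j _) hg
    rw [Finset.insert_erase hj'] at this
    exact sqfreeForms_mono (Finset.erase_subset i V) _ this

omit [Fintype F] [DecidableEq F] [Fintype ι] in
theorem IsBinomialProduct.mem_sqfreeForms {V : Finset ι} {d : ℕ} {f : (ι → Fˣ) → F}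
    (hf : IsBinomialProduct V d f) : f ∈ sqfreeForms F V d := by
  induction hf with
  | const V c hc => exact Submodule.smul_mem _ _ (one_mem_sqfreeForms V)
  | mul i j c hi hj hij hc hg ih => exact sub_mul_mem_sqfreeForms c hi hj hij ih

omit [Fintype F] [DecidableEq F] [Fintype ι] [DecidableEq ι] in
theorem smul_coordFun_ne_zero {c : F} (hc : c ≠ 0) (j : ι) (P : ι → Fˣ) :
    (c • coordFun F j) P ≠ 0 := by
  simp [coordFun, hc]

theorem hammingNorm_binomial_mul {i j : ι} {c : F} (hij : i ≠ j) (hc : c ≠ 0)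
    {g : (ι → Fˣ) → F} (hg : IndepOfCoord i g) :
    (Fintype.card Fˣ : ℚ) * hammingNorm ((coordFun F i - c • coordFun F j) * g) =
      (Fintype.card Fˣ - 1) * hammingNorm g :=
  hammingNorm_coordFun_sub_mul (smul_coordFun_ne_zero hc j)
    ((indepOfCoord_coordFun hij).smul c) hg

theorem IsBinomialProduct.hammingNorm_eq {V : Finset ι} {d : ℕ} {f : (ι → Fˣ) → F}
    (hf : IsBinomialProduct V d f) :
    (Fintype.card Fˣ : ℚ) ^ d * hammingNorm f =
      (Fintype.card Fˣ - 1) ^ d * Fintype.card Fˣ ^ Fintype.card ι := by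
  induction hf with
  | const V c hc =>
    rw [hammingNorm_of_forall_ne_zero (by simpa using hc)]
    simp
  | mul i j c hi hj hij hc hg ih =>
    have h1 := hammingNorm_binomial_mul (F := F) hij hc (indepOfCoord_of_mem_sqfreeForms (i := i)
      (by simp) hg.mem_sqfreeForms)
    rw [pow_succ, mul_assoc, h1, pow_succ]
    linear_combination ((Fintype.card Fˣ : ℚ) - 1) * ih

/-- Forms of degree one are binomials or have large weight. -/
theorem linear_dichotomy {V : Finset ι} {t : ι} (ht : t ∉ V) {a : F} (ha : a ≠ 0)
    {l : (ι → Fˣ) → F} (hl : l ∈ sqfreeForms F V 1) :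
    IsBinomialProduct (insert t V) 1 (coordFun F t * (a • 1) + l) ∨
      ((Fintype.card Fˣ : ℚ) - 1) * (Fintype.card Fˣ ^ 2 + 1) *
        Fintype.card Fˣ ^ Fintype.card ι ≤
        Fintype.card Fˣ ^ 3 * hammingNorm (coordFun F t * (a • 1) + l) := by
  have hQ : (1 : ℚ) ≤ Fintype.card Fˣ := one_le_card_units
  set Q : ℚ := (Fintype.card Fˣ : ℚ) with hQd
  have hQn : (1 : ℚ) ≤ Q ^ Fintype.card ι := one_le_pow₀ hQ
  have key : Q * hammingNorm (coordFun F t * (a • 1) + l) =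
      Q ^ (Fintype.card ι + 1) - hammingNorm l :=
    hammingNorm_coordFun_mul_add (by simpa using ha) (fun P b => rfl)
      (indepOfCoord_of_mem_sqfreeForms ht hl)
  -- By `key`, a lower bound for the whole form is an upper bound for the weight of `l`. It holds if
  -- `l = 0`. If `l = b x_u + h` with `h ≠ 0`, the same identity applies to `l`, and the minimal
  -- weight bound for `h` gives exactly this constant.
  have suff : Q ^ 2 * hammingNorm l ≤ (Q ^ 2 - Q + 1) * Q ^ Fintype.card ι →
      (Q - 1) * (Q ^ 2 + 1) * Q ^ Fintype.card ι ≤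
        Q ^ 3 * hammingNorm (coordFun F t * (a • 1) + l) := by
    intro h
    have : Q ^ 3 * hammingNorm (coordFun F t * (a • 1) + l) =
      Q ^ 2 * (Q ^ (Fintype.card ι + 1) - hammingNorm l) := by rw [← key]; ring
    rw [this, pow_succ Q (Fintype.card ι)]
    linarith
  by_cases hl0 : l = 0
  · right
    apply suff
    rw [hl0, hammingNorm_zero]
    have : 0 ≤ Q ^ 2 - Q + 1 := by nlinarith
    simpa using mul_nonneg this (by linarith)
  obtain ⟨u, hu, g, hg, hg0, h, hh, rfl⟩ := exists_ne_zero_eq_coordFun_mul_add hl hl0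
  obtain ⟨b, rfl⟩ := exists_smul_one_of_mem_sqfreeForms_zero hg
  have hb : b ≠ 0 := by
    rintro rfl
    simp at hg0
  by_cases hh0 : h = 0
  · left
    have htu : t ≠ u := fun e => ht (e ▸ hu)
    have e : coordFun F t * (a • 1) + (coordFun F u * (b • 1) + h) =
        (coordFun F t - (-b / a) • coordFun F u) * (a • (1 : (ι → Fˣ) → F)) := by
      funext P
      simp only [hh0, Pi.add_apply, Pi.mul_apply, Pi.sub_apply, Pi.smul_apply, Pi.one_apply,
        Pi.zero_apply, smul_eq_mul]
      field_simp
      ring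
    rw [e]
    exact .mul t u _ (Finset.mem_insert_self t V) (Finset.mem_insert_of_mem hu) htu
      (by simp [ha, hb]) (.const _ a ha)
  · right
    apply suff
    have h1 := min_le_hammingNorm hh hh0
    have h2 : Q * hammingNorm (coordFun F u * (b • 1) + h) =
        Q ^ (Fintype.card ι + 1) - hammingNorm h :=
      hammingNorm_coordFun_mul_add (by simpa using hb) (fun P b => rfl)
        (indepOfCoord_of_mem_sqfreeForms (Finset.notMem_erase u V) hh)
    rw [pow_one, pow_one, ← hQd] at h1
    have h3 : Q ^ 2 * hammingNorm (coordFun F u * (b • 1) + h) =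
      Q * (Q ^ (Fintype.card ι + 1) - hammingNorm h) := by rw [← h2]; ring
    rw [h3, pow_succ Q (Fintype.card ι)]
    linarith

theorem eq_zero_of_hammingNorm_le {g : (ι → Fˣ) → F} {a : ℚ} (ha : 0 < a)
    (h : a * hammingNorm g ≤ 0) : g = 0 := by
  by_contra hg
  have : (0 : ℚ) < hammingNorm g := by exact_mod_cast hammingNorm_pos_iff.mpr hg
  nlinarith [mul_pos ha this]

/-- A squarefree form is divisible by `x_i - c x_j`, or it has many nonzeros among the zeros of
this binomial. -/
theorem binomial_dvd_or_le_card (hF : 3 ≤ Fintype.card Fˣ) {V : Finset ι} {d : ℕ}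
    {h : (ι → Fˣ) → F} {i j : ι} {c : F} (hij : i ≠ j) (hc : c ≠ 0)
    (hh : h ∈ sqfreeForms F V (d + 2)) :
    (∃ h' ∈ sqfreeForms F ((V.erase i).erase j) (d + 1),
        h = (coordFun F i - c • coordFun F j) * h') ∨
      ((Fintype.card Fˣ : ℚ) - 1) ^ (d + 2) * Fintype.card Fˣ ^ Fintype.card ι ≤
        Fintype.card Fˣ ^ (d + 4) *
          (Finset.univ.filter fun P =>
            coordFun F i P - (c • coordFun F j) P = 0 ∧ h P ≠ 0).card := by
  have hQ : (3 : ℚ) ≤ Fintype.card Fˣ := by exact_mod_cast hF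
  set Q : ℚ := (Fintype.card Fˣ : ℚ) with hQd
  -- The form becomes `x_i x_j α + x_i β + x_j γ + δ`, with coefficients free of `x_i` and `x_j`;
  -- `h₁` below is its restriction to `x_i = c x_j`.
  obtain ⟨p, hp, r, hr, rfl⟩ := exists_eq_coordFun_mul_add (i := i) hh
  obtain ⟨α, hα, β, hβ, rfl⟩ := exists_eq_coordFun_mul_add (i := j) hp
  obtain ⟨γ, hγ, δ, hδ, rfl⟩ := exists_eq_coordFun_mul_add (i := j) hr
  set W := (V.erase i).erase j with hW
  have hiW : i ∉ W := by simp [hW]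
  have hjW : j ∉ W := by simp [hW]
  have hm : c • β + γ ∈ sqfreeForms F W (d + 1) := add_mem (Submodule.smul_mem _ _ hβ) hγ
  set h₁ : (ι → Fˣ) → F :=
    coordFun F j ^ 2 * (c • α) + coordFun F j * (c • β + γ) + δ with hh₁
  have hind : IndepOfCoord i h₁ := by
    have hj := indepOfCoord_coordFun (F := F) hij
    rw [hh₁, sq]
    exact (((hj.mul hj).mul ((indepOfCoord_of_mem_sqfreeForms hiW hα).smul c)).add
      (hj.mul (indepOfCoord_of_mem_sqfreeForms hiW hm))).add
      (indepOfCoord_of_mem_sqfreeForms hiW hδ)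
  have hcard := card_graph_mul (h := coordFun F i * (coordFun F j * α + β) +
      (coordFun F j * γ + δ)) (smul_coordFun_ne_zero hc j)
    ((indepOfCoord_coordFun hij).smul c) hind (by
      intro P hP
      simp only [hh₁, Pi.add_apply, Pi.mul_apply, hP, Pi.smul_apply, smul_eq_mul, Pi.pow_apply]
      ring)
  rw [← hQd] at hcard
  have suff : (Q - 1) ^ (d + 2) * Q ^ Fintype.card ι ≤ Q ^ (d + 3) * hammingNorm h₁ →
      (Q - 1) ^ (d + 2) * Q ^ Fintype.card ι ≤ Q ^ (d + 4) *
          (Finset.univ.filter fun P => coordFun F i P - (c • coordFun F j) P = 0 ∧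
            (coordFun F i * (coordFun F j * α + β) + (coordFun F j * γ + δ)) P ≠ 0).card := by
    intro H
    refine H.trans ?_
    have := mul_le_mul_of_nonneg_left hcard (by positivity : 0 ≤ Q ^ (d + 3))
    rw [pow_succ Q (d + 3), mul_assoc]
    exact this
  by_cases hα0 : α = 0
  · by_cases hL : coordFun F j * (c • β + γ) + δ = 0
    · left
      -- The fibre inequality for the zero function forces the coefficient of `x_j` to have weight
      -- zero, as `Q > 1`.
      have hm0 : c • β + γ = 0 := by
        have := le_hammingNorm_coordFun_mul_add' (indepOfCoord_of_mem_sqfreeForms hjW hm)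
          (indepOfCoord_of_mem_sqfreeForms hjW hδ)
        rw [hL, hammingNorm_zero] at this
        refine eq_zero_of_hammingNorm_le (a := Q - 1) (by linarith) (by simpa using this)
      have hδ0 : δ = 0 := by simpa [hm0] using hL
      refine ⟨β, hβ, ?_⟩
      have : γ = -(c • β) := eq_neg_of_add_eq_zero_right hm0
      rw [hα0, hδ0, this]
      funext P
      simp
      ring
    · right
      apply suff
      have hLm : coordFun F j * (c • β + γ) + δ ∈ sqfreeForms F (insert j W) (d + 2) :=
        add_mem (coordFun_mul_mem_sqfreeForms hjW hm)
          (sqfreeForms_mono (Finset.subset_insert j W) _ hδ)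
      have e : h₁ = coordFun F j * (c • β + γ) + δ := by simp [hh₁, hα0]
      rw [e]
      refine (min_le_hammingNorm hLm hL).trans ?_
      -- The bound just used is stronger than required by a factor `Q`; the quadratic case below
      -- needs this slack.
      rw [← hQd]
      gcongr
      · linarith
      · omega
  · right
    apply suff
    have hcα : c • α ≠ 0 := smul_ne_zero hc hα0
    have hcαm : c • α ∈ sqfreeForms F W d := Submodule.smul_mem _ _ hα
    have h1 := min_le_hammingNorm hcαm hcα
    have h2 := le_hammingNorm_quadratic (indepOfCoord_of_mem_sqfreeForms hjW hcαm)
      (indepOfCoord_of_mem_sqfreeForms hjW hm) (indepOfCoord_of_mem_sqfreeForms hjW hδ)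
    rw [← hh₁, ← hQd] at h2
    rw [← hQd] at h1
    -- Here `h₁` is quadratic in `x_j`, with at least `Q - 2` nonzeros on each line where `α ≠ 0`.
    -- The comparison `(Q-1)² ≤ Q²(Q-2)` uses `Q ≥ 3`, that is `q ≥ 4`; it fails for `Q = 2`.
    calc (Q - 1) ^ (d + 2) * Q ^ Fintype.card ι
        = (Q - 1) ^ 2 * ((Q - 1) ^ d * Q ^ Fintype.card ι) := by ring
      _ ≤ (Q ^ 2 * (Q - 2)) * ((Q - 1) ^ d * Q ^ Fintype.card ι) := by
          have : 0 ≤ Q - 1 := by linarith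
          gcongr ?_ * _
          nlinarith [mul_nonneg (sq_nonneg Q) (by linarith : 0 ≤ Q - 3)]
      _ ≤ (Q ^ 2 * (Q - 2)) * (Q ^ d * hammingNorm (c • α)) := by
          have : 0 ≤ Q - 2 := by linarith
          gcongr
      _ = Q ^ (d + 2) * ((Q - 2) * hammingNorm (c • α)) := by ring
      _ ≤ Q ^ (d + 2) * (Q * hammingNorm h₁) := by gcongr
      _ = Q ^ (d + 3) * hammingNorm h₁ := by ring

/-- Induction on the factorization of `g`. A binomial that divides `h` is a factor of the whole
form, and both alternatives survive multiplication by it. A binomial that does not divide `h` yields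
the gap at once. -/
theorem IsBinomialProduct.dichotomy (hF : 3 ≤ Fintype.card Fˣ) {V : Finset ι} {d : ℕ}
    {g : (ι → Fˣ) → F} (hg : IsBinomialProduct V d g) {t : ι} (ht : t ∉ V) {h : (ι → Fˣ) → F}
    (hh : h ∈ sqfreeForms F V (d + 1)) :
    IsBinomialProduct (insert t V) (d + 1) (coordFun F t * g + h) ∨
      ((Fintype.card Fˣ : ℚ) - 1) ^ (d + 1) * (Fintype.card Fˣ ^ 2 + 1) *
        Fintype.card Fˣ ^ Fintype.card ι ≤
        Fintype.card Fˣ ^ (d + 3) * hammingNorm (coordFun F t * g + h) := by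
  have hQ : (3 : ℚ) ≤ Fintype.card Fˣ := by exact_mod_cast hF
  induction hg generalizing h with
  | const V c hc =>
    simpa using linear_dichotomy ht hc hh
  | @mul V d g i j c hi hj hij hc hg ih =>
    have hti : t ≠ i := fun e => ht (e ▸ hi)
    have htj : t ≠ j := fun e => ht (e ▸ hj)
    have ht' : t ∉ (V.erase i).erase j := fun e =>
      ht (Finset.mem_of_mem_erase (Finset.mem_of_mem_erase e))
    have hbin : IsBinomialProduct V (d + 1) ((coordFun F i - c • coordFun F j) * g) :=
      .mul i j c hi hj hij hc hg
    rcases binomial_dvd_or_le_card hF hij hc hh with ⟨h', hh', rfl⟩ | hbig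
    · have e : coordFun F t * ((coordFun F i - c • coordFun F j) * g) +
          (coordFun F i - c • coordFun F j) * h' =
          (coordFun F i - c • coordFun F j) * (coordFun F t * g + h') := by ring
      have hset : ((insert t V).erase i).erase j = insert t ((V.erase i).erase j) := by
        rw [Finset.erase_insert_of_ne hti, Finset.erase_insert_of_ne htj]
      rw [e]
      rcases ih ht' hh' with h1 | h1
      · left
        exact .mul i j c (Finset.mem_insert_of_mem hi) (Finset.mem_insert_of_mem hj) hij hc
          (hset ▸ h1)
      · right
        have h2 := hammingNorm_binomial_mul (F := F) hij hc (g := coordFun F t * g + h')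
          (((indepOfCoord_coordFun hti.symm).mul (indepOfCoord_of_mem_sqfreeForms (by simp)
            hg.mem_sqfreeForms)).add (indepOfCoord_of_mem_sqfreeForms (by simp) hh'))
        set Q : ℚ := (Fintype.card Fˣ : ℚ)
        have h3 := mul_le_mul_of_nonneg_left h1 (by linarith : 0 ≤ Q - 1)
        calc (Q - 1) ^ (d + 1 + 1) * (Q ^ 2 + 1) * Q ^ Fintype.card ι
            = (Q - 1) * ((Q - 1) ^ (d + 1) * (Q ^ 2 + 1) * Q ^ Fintype.card ι) := by ring
          _ ≤ _ := h3
          _ = Q ^ (d + 3) * ((Q - 1) * hammingNorm (coordFun F t * g + h')) := by ring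
          _ = _ := by rw [← h2]; ring
    · right
      have h1 := le_hammingNorm_coordFun_mul_add
        (indepOfCoord_of_mem_sqfreeForms ht hbin.mem_sqfreeForms)
        (indepOfCoord_of_mem_sqfreeForms ht hh)
      have h2 := hbin.hammingNorm_eq
      have h3 : (Finset.univ.filter fun P =>
            coordFun F i P - (c • coordFun F j) P = 0 ∧ h P ≠ 0).card ≤
          (Finset.univ.filter fun P =>
            ((coordFun F i - c • coordFun F j) * g) P = 0 ∧ h P ≠ 0).card := by
        refine Finset.card_le_card fun P hP => ?_
        simp only [Finset.mem_filter, Finset.mem_univ, true_and, Pi.mul_apply,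
          Pi.sub_apply] at hP ⊢
        exact ⟨by rw [hP.1, zero_mul], hP.2⟩
      set Q : ℚ := (Fintype.card Fˣ : ℚ)
      set M : ℚ := ((Finset.univ.filter fun P =>
            ((coordFun F i - c • coordFun F j) * g) P = 0 ∧ h P ≠ 0).card : ℚ)
      have h4 : (Q - 1) ^ (d + 2) * Q ^ Fintype.card ι ≤ Q ^ (d + 4) * M := by
        refine hbig.trans ?_
        gcongr
        exact Nat.cast_le.mpr h3
      have h5 := mul_le_mul_of_nonneg_left h1 (by positivity : 0 ≤ Q ^ (d + 3))
      -- Of the factor `Q² + 1`, the `Q²` comes from the weight of the binomial product and the `1`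
      -- from the zeros of that product where `h ≠ 0`.
      calc (Q - 1) ^ (d + 1 + 1) * (Q ^ 2 + 1) * Q ^ Fintype.card ι
          = Q ^ 2 * (Q - 1) * ((Q - 1) ^ (d + 1) * Q ^ Fintype.card ι) +
              (Q - 1) ^ (d + 2) * Q ^ Fintype.card ι := by ring
        _ ≤ Q ^ 2 * (Q - 1) * ((Q - 1) ^ (d + 1) * Q ^ Fintype.card ι) + Q ^ (d + 4) * M := by
            gcongr
        _ = Q ^ (d + 3) * ((Q - 1) *
              hammingNorm ((coordFun F i - c • coordFun F j) * g) + Q * M) := by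
            rw [← h2]; ring
        _ ≤ _ := h5
        _ = _ := by ring

/-- A squarefree form of degree `d` is a product of binomials, hence has minimal weight, or its
weight is at least the next-to-minimal one. -/
theorem isBinomialProduct_or_le_hammingNorm (hF : 3 ≤ Fintype.card Fˣ) {V : Finset ι} {d : ℕ}
    {f : (ι → Fˣ) → F} (hf : f ∈ sqfreeForms F V d) (h0 : f ≠ 0) :
    IsBinomialProduct V d f ∨
      ((Fintype.card Fˣ : ℚ) - 1) ^ d * (Fintype.card Fˣ ^ 2 + 1) *
        Fintype.card Fˣ ^ Fintype.card ι ≤ Fintype.card Fˣ ^ (d + 2) * hammingNorm f := by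
  have hQ : (3 : ℚ) ≤ Fintype.card Fˣ := by exact_mod_cast hF
  induction d generalizing V f with
  | zero =>
    left
    obtain ⟨c, rfl⟩ := exists_smul_one_of_mem_sqfreeForms_zero hf
    refine .const V c ?_
    rintro rfl
    simp at h0
  | succ d ih =>
    obtain ⟨i, hi, g, hg, hg0, h, hh, rfl⟩ := exists_ne_zero_eq_coordFun_mul_add hf h0
    have hiV := Finset.notMem_erase i V
    rcases ih hg hg0 with h1 | h1
    · have := h1.dichotomy hF hiV hh
      rwa [Finset.insert_erase hi] at this
    · right
      have h2 := le_hammingNorm_coordFun_mul_add' (indepOfCoord_of_mem_sqfreeForms hiV hg)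
        (indepOfCoord_of_mem_sqfreeForms hiV hh)
      set Q : ℚ := (Fintype.card Fˣ : ℚ)
      have h3 := mul_le_mul_of_nonneg_left h1 (by linarith : 0 ≤ Q - 1)
      have h4 := mul_le_mul_of_nonneg_left h2 (by positivity : 0 ≤ Q ^ (d + 2))
      calc (Q - 1) ^ (d + 1) * (Q ^ 2 + 1) * Q ^ Fintype.card ι
          = (Q - 1) * ((Q - 1) ^ d * (Q ^ 2 + 1) * Q ^ Fintype.card ι) := by ring
        _ ≤ _ := h3
        _ = Q ^ (d + 2) * ((Q - 1) * hammingNorm g) := by ring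
        _ ≤ _ := h4
        _ = _ := by ring

end Weights

/-! ### Weights of the extremal forms. -/

section ExplicitForms

variable {F ι : Type*} [Field F] [Fintype F] [DecidableEq F] [Fintype ι] [DecidableEq ι]

/-- Each new binomial uses two fresh variables, so the product stays squarefree and the weight is
scaled by `(Q-1)/Q`. The factor `l` will be `1` for the minimal weight and the four-term linear form
for the next one. -/
theorem prod_binomial_mul {κ : Type*} [DecidableEq κ] {a b : κ → ι} (ha : a.Injective)
    (hb : b.Injective) (hab : ∀ k l, a k ≠ b l) {V : Finset ι} (haV : ∀ k, a k ∉ V)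
    (hbV : ∀ k, b k ∉ V) {e : ℕ} {l : (ι → Fˣ) → F} (hl : l ∈ sqfreeForms F V e)
    (T : Finset κ) :
    (∏ k ∈ T, (coordFun F (a k) - coordFun F (b k))) * l ∈
        sqfreeForms F (V ∪ T.image a ∪ T.image b) (T.card + e) ∧
      (Fintype.card Fˣ : ℚ) ^ T.card *
        hammingNorm ((∏ k ∈ T, (coordFun F (a k) - coordFun F (b k))) * l) =
        (Fintype.card Fˣ - 1) ^ T.card * hammingNorm l := by
  induction T using Finset.induction_on with
  | empty => simpa using hl
  | insert k T hk ih =>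
    obtain ⟨h1, h2⟩ := ih
    have hka : a k ∉ V ∪ T.image a ∪ T.image b := by
      simp only [Finset.mem_union, Finset.mem_image, not_or, not_exists, not_and]
      exact ⟨⟨haV k, fun x hx e => hk (ha e ▸ hx)⟩, fun x _ e => hab k x e.symm⟩
    have hkb : b k ∉ V ∪ T.image a ∪ T.image b := by
      simp only [Finset.mem_union, Finset.mem_image, not_or, not_exists, not_and]
      exact ⟨⟨hbV k, fun x _ e => hab x k e⟩, fun x hx e => hk (hb e ▸ hx)⟩
    rw [Finset.prod_insert hk, Finset.card_insert_of_notMem hk, mul_assoc]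
    have e1 : coordFun F (a k) - coordFun F (b k) =
        coordFun F (a k) - (1 : F) • coordFun F (b k) := by rw [one_smul]
    rw [e1]
    constructor
    · rw [add_right_comm]
      refine sub_mul_mem_sqfreeForms 1 ?_ ?_ (hab k k) (sqfreeForms_mono ?_ _ h1)
      · simp
      · simp
      · intro x hx
        refine Finset.mem_erase.mpr ⟨fun e => hkb (e ▸ hx),
          Finset.mem_erase.mpr ⟨fun e => hka (e ▸ hx), ?_⟩⟩
        simp only [Finset.mem_union, Finset.image_insert, Finset.mem_insert] at hx ⊢
        tauto
    · have h3 := hammingNorm_binomial_mul (F := F) (hab k k) one_ne_zero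
        (indepOfCoord_of_mem_sqfreeForms hka h1)
      rw [pow_succ, mul_assoc, h3, pow_succ]
      linear_combination ((Fintype.card Fˣ : ℚ) - 1) * h2

/-- Peeling off `t` and then `u` by `Q|x_i a + h| = Q^(n+1) - |h|` (with `a` nowhere zero) reduces
to the binomial in `v` and `w`. -/
theorem hammingNorm_four_term {t u v w : ι} (htu : t ≠ u) (htv : t ≠ v) (htw : t ≠ w)
    (huv : u ≠ v) (huw : u ≠ w) (hvw : v ≠ w) :
    (Fintype.card Fˣ : ℚ) ^ 3 *
        hammingNorm (coordFun F t - coordFun F u + coordFun F v - coordFun F w) =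
      (Fintype.card Fˣ - 1) * (Fintype.card Fˣ ^ 2 + 1) *
        Fintype.card Fˣ ^ Fintype.card ι := by
  have ht := fun {x : ι} (h : t ≠ x) => indepOfCoord_coordFun (F := F) h
  have hu := fun {x : ι} (h : u ≠ x) => indepOfCoord_coordFun (F := F) h
  have h1 := hammingNorm_coordFun_mul_add (F := F) (i := t) (g := 1)
    (h := coordFun F v - coordFun F u - coordFun F w) (by simp) (fun P b => rfl)
    (((ht htv).sub (ht htu)).sub (ht htw))
  have h2 := hammingNorm_coordFun_mul_add (F := F) (i := u) (g := -1)
    (h := coordFun F v - coordFun F w) (by simp) (fun P b => rfl)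
    ((hu huv).sub (hu huw))
  have h3 := hammingNorm_binomial_mul (F := F) (g := 1) (c := 1) hvw one_ne_zero
    (fun P b => rfl)
  have h4 : (hammingNorm (1 : (ι → Fˣ) → F) : ℚ) = Fintype.card Fˣ ^ Fintype.card ι := by
    rw [hammingNorm_of_forall_ne_zero (by simp)]
    simp
  have e1 : coordFun F t * 1 + (coordFun F v - coordFun F u - coordFun F w) =
    coordFun F t - coordFun F u + coordFun F v - coordFun F w := by ring
  have e2 : coordFun F u * -1 + (coordFun F v - coordFun F w) =
    coordFun F v - coordFun F u - coordFun F w := by ring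
  rw [e1] at h1
  rw [e2] at h2
  rw [one_smul, mul_one, h4] at h3
  linear_combination (Fintype.card Fˣ : ℚ) ^ 2 * h1 - (Fintype.card Fˣ : ℚ) * h2 + h3

end ExplicitForms

/-! ### Identification of the toric code with the squarefree forms. -/

section ToricCode

variable {F : Type*} [Field F] {s : ℕ}

/-- The points of the torus, as tuples of units. -/
def unitsEquivTorus (F : Type*) [Field F] (s : ℕ) : (Fin s → Fˣ) ≃ torus F s where
  toFun P := ⟨fun i => P i, fun i => (P i).ne_zero⟩
  invFun P := fun i => Units.mk0 (P.1 i) (P.2 i)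
  left_inv P := by ext; rfl
  right_inv P := rfl

/-- Functions on the torus as functions of tuples of units. -/
def pullUnits (F : Type*) [Field F] (s : ℕ) :
    (torus F s → F) ≃ₗ[F] ((Fin s → Fˣ) → F) :=
  LinearEquiv.funCongrLeft F F (unitsEquivTorus F s)

theorem pullUnits_evalMap_mk (f : MvPolynomial (Fin s) F) :
    pullUnits F s (evalMap (torus F s) (Ideal.Quotient.mk _ f)) =
      aeval (fun i => coordFun F i) f := by
  have : pullUnits F s (evalMap (torus F s) (Ideal.Quotient.mk _ f)) =
      fun P : Fin s → Fˣ => aeval (fun i => (P i : F)) f := rfl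
  rw [this]
  funext P
  have h := comp_aeval_apply (R := F) (fun i => coordFun F i)
    (Pi.evalAlgHom F (fun _ : Fin s → Fˣ => F) P) f
  exact h.symm

theorem evalMap_injective (X : Set (Fin s → F)) : Function.Injective (evalMap X) := by
  rw [injective_iff_map_eq_zero]
  intro x hx
  obtain ⟨f, rfl⟩ := Ideal.Quotient.mk_surjective x
  rw [Ideal.Quotient.eq_zero_iff_mem]
  intro P hP
  exact congrFun hx ⟨P, hP⟩

theorem hammingNorm_pullUnits [Fintype F] [DecidableEq F] (c : torus F s → F) :
    hammingNorm (pullUnits F s c) = hammingNorm c := by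
  refine Finset.card_equiv (unitsEquivTorus F s) fun P => ?_
  simp only [Finset.mem_filter, Finset.mem_univ, true_and]
  rfl

/-- This inclusion is enough to see that the lattice points of the hypersimplex are 0/1 vectors with
`d` ones. -/
theorem hypersimplex_subset (s d : ℕ) :
    hypersimplex s d ⊆ {x | (∀ i, 0 ≤ x i ∧ x i ≤ 1) ∧ ∑ i, x i = d} := by
  refine convexHull_min ?_ ?_
  · rintro x ⟨A, hA, rfl⟩
    have hx : ∀ i, (∑ j ∈ A, Pi.single j (1 : ℝ) : Fin s → ℝ) i = if i ∈ A then 1 else 0 := by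
      intro i
      simp [Finset.sum_apply, Pi.single_apply]
    refine ⟨fun i => ?_, ?_⟩
    · rw [hx]
      split_ifs <;> simp
    · simp_rw [hx]
      simp [hA]
  · intro x hx y hy a b ha hb hab
    refine ⟨fun i => ?_, ?_⟩
    · obtain ⟨h1, h2⟩ := hx.1 i
      obtain ⟨h3, h4⟩ := hy.1 i
      simp only [Pi.add_apply, Pi.smul_apply, smul_eq_mul]
      exact ⟨by positivity, by nlinarith⟩
    · simp only [Pi.add_apply, Pi.smul_apply, smul_eq_mul, Finset.sum_add_distrib,
        ← Finset.mul_sum, hx.2, hy.2]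
      rw [← add_mul, hab, one_mul]

theorem monomial_eq_prod_of_mem_hypersimplex {d : ℕ} {α : Fin s →₀ ℕ}
    (hα : (fun i => (α i : ℝ)) ∈ hypersimplex s d) :
    α.support.card = d ∧ monomial α (1 : F) = ∏ i ∈ α.support, X i := by
  obtain ⟨h1, h2⟩ := hypersimplex_subset s d hα
  have h3 : ∀ i ∈ α.support, α i = 1 := by
    intro i hi
    have : α i ≤ 1 := Nat.cast_le_one.mp (h1 i).2
    have := Finsupp.mem_support_iff.mp hi
    omega
  constructor
  · have h4 : ∑ i, α i = d := by
      simp only at h2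
      exact_mod_cast h2
    rw [← h4, Finset.card_eq_sum_ones, ← Finset.sum_subset (Finset.subset_univ α.support)
      (fun i _ hi => Finsupp.notMem_support_iff.mp hi)]
    exact Finset.sum_congr rfl fun i hi => (h3 i hi).symm
  · rw [monomial_eq, C_1, one_mul, Finsupp.prod]
    exact Finset.prod_congr rfl fun i hi => by rw [h3 i hi, pow_one]

theorem exists_mem_hypersimplex_monomial_eq_prod (A : Finset (Fin s)) :
    ∃ α : Fin s →₀ ℕ, (fun i => (α i : ℝ)) ∈ hypersimplex s A.card ∧
      monomial α (1 : F) = ∏ i ∈ A, X i := by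
  refine ⟨∑ i ∈ A, Finsupp.single i 1, subset_convexHull ℝ _ ⟨A, rfl, ?_⟩, ?_⟩
  · funext i
    simp [Finsupp.single_apply, Pi.single_apply, Finset.sum_apply, eq_comm]
  · rw [monomial_sum_one]
    rfl

theorem map_pullUnits_toricCode (d : ℕ) :
    (toricCode F (hypersimplex s d)).map (pullUnits F s).toLinearMap =
      sqfreeForms F Finset.univ d := by
  rw [toricCode, toricSpace, ← Submodule.map_comp, Submodule.map_span, sqfreeForms]
  congr 1
  have key : ∀ A : Finset (Fin s), (pullUnits F s) (evalMap (torus F s)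
      (Ideal.Quotient.mk _ (∏ i ∈ A, X i))) = ∏ i ∈ A, coordFun F i := by
    intro A
    rw [pullUnits_evalMap_mk, map_prod]
    simp
  ext f
  constructor
  · rintro ⟨_, ⟨α, hα, rfl⟩, rfl⟩
    obtain ⟨h1, h2⟩ := monomial_eq_prod_of_mem_hypersimplex (F := F) hα
    refine ⟨α.support, Finset.subset_univ _, h1, ?_⟩
    rw [h2]
    exact key _
  · rintro ⟨A, -, rfl, rfl⟩
    obtain ⟨α, h1, h2⟩ := exists_mem_hypersimplex_monomial_eq_prod (F := F) A
    refine ⟨_, ⟨α, h1, rfl⟩, ?_⟩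
    rw [h2]
    exact key A

theorem mem_nonzeroWeights_toricCode [Fintype F] [DecidableEq F] {d w : ℕ} :
    w ∈ nonzeroWeights (toricCode F (hypersimplex s d)) ↔
      ∃ f ∈ sqfreeForms F (Finset.univ : Finset (Fin s)) d, f ≠ 0 ∧ hammingNorm f = w := by
  rw [← map_pullUnits_toricCode]
  constructor
  · rintro ⟨c, hc, h0, rfl⟩
    exact ⟨_, Submodule.mem_map_of_mem hc, by simpa using h0, hammingNorm_pullUnits c⟩
  · rintro ⟨_, ⟨c, hc, rfl⟩, h0, rfl⟩
    exact ⟨c, hc, by simpa using h0, (hammingNorm_pullUnits c).symm⟩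

/-- Evaluation is injective modulo the vanishing ideal, so membership of a class can be tested on
its values. -/
theorem mk_mem_toricSpace {d : ℕ} {f : MvPolynomial (Fin s) F}
    (hf : aeval (fun i => coordFun F i) f ∈ sqfreeForms F (Finset.univ : Finset (Fin s)) d) :
    Ideal.Quotient.mk (vanishingIdeal F (torus F s)) f ∈ toricSpace F (hypersimplex s d) := by
  rw [← map_pullUnits_toricCode, ← pullUnits_evalMap_mk] at hf
  obtain ⟨c, ⟨x, hx, rfl⟩, hc⟩ := hf
  rwa [← evalMap_injective _ ((pullUnits F s).injective hc)]

end ToricCode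

/-! ### Forms attaining the two smallest weights, and the conclusion. -/

section NextToMinimal

variable {F : Type*} [Field F] [Fintype F] [DecidableEq F]

theorem exists_sqfreeForm_minimal {s d : ℕ} (hs : 2 * d ≤ s) :
    ∃ f ∈ sqfreeForms F (Finset.univ : Finset (Fin s)) d,
      (Fintype.card Fˣ : ℚ) ^ d * hammingNorm f =
        (Fintype.card Fˣ - 1) ^ d * Fintype.card Fˣ ^ s := by
  obtain ⟨h1, h2⟩ := prod_binomial_mul (F := F) (ι := Fin s) (κ := Fin d)
    (a := fun k => ⟨k, by omega⟩) (b := fun k => ⟨d + k, by omega⟩) (V := ∅) (e := 0) (l := 1)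
    (fun k l h => by simpa [Fin.ext_iff] using h) (fun k l h => by simpa [Fin.ext_iff] using h)
    (fun k l h => by have := Fin.ext_iff.mp h; simp only at this; omega)
    (by simp) (by simp) (one_mem_sqfreeForms _) Finset.univ
  rw [Finset.card_univ, Fintype.card_fin] at h1 h2
  refine ⟨_, sqfreeForms_mono (Finset.subset_univ _) _ h1, ?_⟩
  rw [h2, hammingNorm_of_forall_ne_zero (f := (1 : (Fin s → Fˣ) → F)) (by simp)]
  simp

theorem nextToMinimalPoly_mem_and_hammingNorm {s d : ℕ} (hd : 1 ≤ d) (hs : 2 * d + 2 ≤ s) :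
    aeval (fun i => coordFun F i) (nextToMinimalPoly F s d hs) ∈
        sqfreeForms F (Finset.univ : Finset (Fin s)) d ∧
      (Fintype.card Fˣ : ℚ) ^ (d + 2) *
        hammingNorm (aeval (fun i => coordFun F i) (nextToMinimalPoly F s d hs)) =
        (Fintype.card Fˣ - 1) ^ d * (Fintype.card Fˣ ^ 2 + 1) * Fintype.card Fˣ ^ s := by
  set t : Fin s := ⟨2 * d - 2, by omega⟩ with ht
  set u : Fin s := ⟨2 * d - 1, by omega⟩ with hu
  set v : Fin s := ⟨2 * d, by omega⟩ with hv
  set w : Fin s := ⟨2 * d + 1, by omega⟩ with hw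
  have hl : coordFun F t - coordFun F u + coordFun F v - coordFun F w ∈
      sqfreeForms F {t, u, v, w} 1 :=
    sub_mem (add_mem (sub_mem (coordFun_mem_sqfreeForms (by simp))
      (coordFun_mem_sqfreeForms (by simp))) (coordFun_mem_sqfreeForms (by simp)))
      (coordFun_mem_sqfreeForms (by simp))
  have h4 := hammingNorm_four_term (F := F) (t := t) (u := u) (v := v) (w := w)
    (by simp [ht, hu]; omega) (by simp [ht, hv]; omega) (by simp [ht, hw]; omega)
    (by simp [hu, hv]; omega) (by simp [hu, hw]) (by simp [hv, hw])
  obtain ⟨h1, h2⟩ := prod_binomial_mul (F := F) (ι := Fin s) (κ := Fin (d - 1))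
    (a := fun k => ⟨k, by omega⟩) (b := fun k => ⟨d - 1 + k, by omega⟩)
    (fun k l h => by simpa [Fin.ext_iff] using h) (fun k l h => by simpa [Fin.ext_iff] using h)
    (fun k l h => by have := Fin.ext_iff.mp h; simp only at this; omega)
    (fun k => by simp [ht, hu, hv, hw]; omega) (fun k => by simp [ht, hu, hv, hw]; omega)
    hl Finset.univ
  have e : aeval (fun i => coordFun F i) (nextToMinimalPoly F s d hs) =
      (∏ k : Fin (d - 1), (coordFun F (⟨k, by omega⟩ : Fin s) -
        coordFun F (⟨d - 1 + k, by omega⟩ : Fin s))) *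
        (coordFun F t - coordFun F u + coordFun F v - coordFun F w) := by
    simp [nextToMinimalPoly, ht, hu, hv, hw]
  rw [Finset.card_univ, Fintype.card_fin] at h1 h2
  rw [e]
  obtain ⟨n, rfl⟩ : ∃ n, d = n + 1 := ⟨d - 1, by omega⟩
  rw [Fintype.card_fin] at h4
  refine ⟨sqfreeForms_mono (Finset.subset_univ _) _ h1, ?_⟩
  calc _ = (Fintype.card Fˣ : ℚ) ^ 3 * ((Fintype.card Fˣ : ℚ) ^ n * _) := by
        rw [← mul_assoc, ← pow_add]; congr 2; ring
    _ = _ := by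
        refine (congrArg ((Fintype.card Fˣ : ℚ) ^ 3 * ·) h2).trans ?_
        simp only [Nat.add_sub_cancel]
        rw [mul_left_comm, h4]
        ring

end NextToMinimal

end

theorem theorem4p4 {F : Type*} [Field F] [Fintype F] [DecidableEq F] (q s d : ℕ)
    (hF : Fintype.card F = q) (hq : 4 ≤ q) (hd : 3 ≤ d) (hs : 2 * d + 2 ≤ s) :
    IsNextToMinimalWeight (toricCode F (hypersimplex s d))
        ((q - 2) ^ d * (q - 1) ^ (s - d) + (q - 2) ^ d * (q - 1) ^ (s - d - 2)) ∧
      Ideal.Quotient.mk (MvPolynomial.vanishingIdeal F (torus F s))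
          (nextToMinimalPoly F s d hs) ∈ toricSpace F (hypersimplex s d) ∧
      hammingNorm (evalMap (torus F s)
          (Ideal.Quotient.mk (MvPolynomial.vanishingIdeal F (torus F s))
            (nextToMinimalPoly F s d hs))) =
        (q - 2) ^ d * (q - 1) ^ (s - d) + (q - 2) ^ d * (q - 1) ^ (s - d - 2) := by
  -- With `q = m + 2` and `s = d + 2 + k`, the truncated subtractions disappear: `Q = m + 1`, and
  -- the rational bounds cast back to natural numbers.
  obtain ⟨m, rfl⟩ : ∃ m, q = m + 2 := ⟨q - 2, by omega⟩
  obtain ⟨k, hk⟩ : ∃ k, s = d + 2 + k := ⟨s - (d + 2), by omega⟩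
  have hcard : Fintype.card Fˣ = m + 1 := by
    rw [Fintype.card_units, hF]
    rfl
  have hm : 2 ≤ m := by omega
  have hcardQ : (Fintype.card Fˣ : ℚ) = m + 1 := by
    rw [hcard]
    push_cast
    ring
  have e1 : s - d = k + 2 := by omega
  have e2 : m + 2 - 1 = m + 1 := rfl
  rw [e1, Nat.add_sub_cancel, e2, Nat.add_sub_cancel]
  have min_iff : ∀ N : ℕ, (Fintype.card Fˣ : ℚ) ^ d * N =
      (Fintype.card Fˣ - 1) ^ d * Fintype.card Fˣ ^ s → N = m ^ d * (m + 1) ^ (k + 2) := by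
    intro N h
    rw [hcardQ, add_sub_cancel_right, hk] at h
    have h' : (m + 1) ^ d * N = m ^ d * (m + 1) ^ (d + 2 + k) := by exact_mod_cast h
    refine Nat.eq_of_mul_eq_mul_left (by positivity : 0 < (m + 1) ^ d) ?_
    rw [h']
    ring
  obtain ⟨hmem, hwt⟩ := nextToMinimalPoly_mem_and_hammingNorm (F := F) (by omega : 1 ≤ d) hs
  have hweight : hammingNorm (aeval (fun i => coordFun F i) (nextToMinimalPoly F s d hs)) =
      m ^ d * (m + 1) ^ (k + 2) + m ^ d * (m + 1) ^ k := by
    set N := hammingNorm (aeval (fun i => coordFun F i) (nextToMinimalPoly F s d hs))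
    rw [hcardQ, add_sub_cancel_right, hk] at hwt
    have h' : (m + 1) ^ (d + 2) * N =
      m ^ d * ((m + 1) ^ 2 + 1) * (m + 1) ^ (d + 2 + k) := by exact_mod_cast hwt
    refine Nat.eq_of_mul_eq_mul_left (by positivity : 0 < (m + 1) ^ (d + 2)) ?_
    rw [h']
    ring
  have hlt : m ^ d * (m + 1) ^ (k + 2) <
      m ^ d * (m + 1) ^ (k + 2) + m ^ d * (m + 1) ^ k :=
    Nat.lt_add_of_pos_right (by positivity)
  have dich : ∀ w ∈ nonzeroWeights (toricCode F (hypersimplex s d)),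
      w = m ^ d * (m + 1) ^ (k + 2) ∨
        m ^ d * (m + 1) ^ (k + 2) + m ^ d * (m + 1) ^ k ≤ w := by
    intro w hw
    obtain ⟨f, hf, h0, rfl⟩ := mem_nonzeroWeights_toricCode.mp hw
    rcases isBinomialProduct_or_le_hammingNorm (by omega) hf h0 with h | h
    · left
      exact min_iff _ (by simpa using h.hammingNorm_eq)
    · right
      rw [Fintype.card_fin, hcardQ, add_sub_cancel_right] at h
      generalize hammingNorm f = N at h ⊢
      rw [hk] at h
      have h' : m ^ d * ((m + 1) ^ 2 + 1) * (m + 1) ^ (d + 2 + k) ≤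
        (m + 1) ^ (d + 2) * N := by exact_mod_cast h
      refine Nat.le_of_mul_le_mul_left (le_trans (le_of_eq ?_) h')
        (by positivity : 0 < (m + 1) ^ (d + 2))
      ring
  refine ⟨⟨m ^ d * (m + 1) ^ (k + 2), ⟨?_, ?_⟩, ⟨?_, hlt⟩, ?_⟩, mk_mem_toricSpace hmem, ?_⟩
  · obtain ⟨f, hf, hfw⟩ := exists_sqfreeForm_minimal (F := F) (by omega : 2 * d ≤ s)
    have hfw := min_iff _ hfw
    refine mem_nonzeroWeights_toricCode.mpr ⟨f, hf, ?_, hfw⟩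
    rw [← hammingNorm_pos_iff, hfw]
    positivity
  · intro w hw
    rcases dich w hw with h | h <;> omega
  · refine mem_nonzeroWeights_toricCode.mpr ⟨_, hmem, ?_, hweight⟩
    rw [← hammingNorm_pos_iff, hweight]
    positivity
  · rintro w ⟨hw, hw'⟩
    rcases dich w hw with h | h <;> omega
  · rw [← hammingNorm_pullUnits, pullUnits_evalMap_mk, hweight]
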